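/- Let $r_1, r_2 \ge 1$ be integers. A digraph with vertex set $[k]=\{1,\dots,k\}$ is a *tournament* if it has no loops and exactly one of the arrows $(i,j)$, $(j,i)$ for any two distinct vertices $i,j$. It is *$(r_1,r_2)$-directional* if for every set $A\subset[k]$ with $|A|=r_1$ there is a set $B\subset[k]\setminus A$ with $|B|=r_2$ such that $(i,j)$ is an arrow for all $i\in A$, $j\in B$. Let $$\mathcal S(r_1,r_2)=\inf\{k\ge r_1+r_2:\ \text{there is an } (r_1,r_2)\text{-directional tournament on } [k]\}.$$ A *1-dependent uniform chain* is a stationary Markov chain $\mathbf X=(X_m)_{m\ge 0}$ on a finite state space such that all entries of the square of its transition matrix are equal. A *hitting time* on $\mathbf X$ is a random variable $T=\inf\{m\ge 0: X_m\in F\}$, where $F$ is a set of states. A family $T_1,\dots,T_n$ is *no-tie* if $\mathbb P(T_i=T_j)=0$ for $i\neq j$. For $A\subset[n]$ put $T^{(A)}=\min_{i\in A}T_i$. Let $n\ge r_1+r_2$, let $\mathbf X$ be a 1-dependent uniform chain and let $\mathcal T_n=\{T_1,\dots,T_n\}$ be a no-tie family of identically distributed hitting times on $\mathbf X$. The zero-sum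 game $G_{r_1,r_2}(\mathbf X,\mathcal T_n)$ is played as follows. Player I chooses $A\subset[n]$ with $|A|=r_1$; then Player II chooses $B\subset[n]\setminus A$ with $|B|=r_2$; then Player I chooses nonempty sets $A'\subset A$ and $B'\subset B$. If $T^{(A')}<T^{(B')}$, Player II pays $|B'|$ to Player I; otherwise Player I pays $|A'|$ to Player II. The game is *favorable to Player II* if the expected payoff of Player II is positive when both players play optimally, that is, if $$\min_{A}\ \max_{B}\ \min_{A',B'}\ \Big(|A'|\,\mathbb P\big(T^{(A')}>T^{(B')}\big)-|B'|\,\mathbb P\big(T^{(A')}<T^{(B')}\big)\Big)>0 .$$ **Theorem.** The infimum $\mathcal S(r_1,r_2)$ is finite, i.e. it is taken over a nonempty set. For every $n\in\mathbb N$, there exist a 1-dependent uniform chain $\mathbf X$ and a no-tie family $\mathcal T_n$ of $n$ identically distributed hitting times on $\mathbf X$ for which the game $G_{r_1,r_2}(\mathbf X,\mathcal T_n)$ is defined (that is, $n\ge r_1+r_2$) and favorable to Player II if and only if $n\ge\mathcal S(r_1,r_2)$. -/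

import Mathlib

open MeasureTheory ProbabilityTheory

universe u v

namespace PenneyGame

/-! ### Uniform one-dependent Markov chains -/

/-- `P` is a transition matrix (row-stochastic matrix) on the finite set `S`. -/
def IsTransitionMatrix {S : Type*} [Fintype S] (P : Matrix S S ℝ) : Prop :=
  (∀ s t, 0 ≤ P s t) ∧ ∀ s, ∑ t, P s t = 1

/-- The process `X` with values in the finite set `S` is a (time-homogeneous) Markov chain with
transition matrix `P`: its finite-dimensional laws are
`ℙ(X₀ = x₀, …, X_m = x_m) = ℙ(X₀ = x₀) P(x₀, x₁) ⋯ P(x_{m-1}, x_m)`. -/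
structure IsMarkovChain {Ω S : Type*} [MeasurableSpace Ω] [Fintype S] [MeasurableSpace S]
    (μ : Measure Ω) (X : ℕ → Ω → S) (P : Matrix S S ℝ) : Prop where
  isTransitionMatrix : IsTransitionMatrix P
  measurable : ∀ m, Measurable (X m)
  path_law : ∀ (m : ℕ) (x : ℕ → S),
    μ.real {ω | ∀ i ≤ m, X i ω = x i} =
      μ.real {ω | X 0 ω = x 0} * ∏ i ∈ Finset.range m, P (x i) (x (i + 1))

/-- A 1-dependent uniform chain: a Markov chain which is stationary (the law of `X m` does not
depend on the time `m`) and for which the square of the transition matrix has all its entries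
equal. -/
def IsOneDependentUniformChain {Ω S : Type*} [MeasurableSpace Ω] [Fintype S] [MeasurableSpace S]
    (μ : Measure Ω) (X : ℕ → Ω → S) : Prop :=
  ∃ P : Matrix S S ℝ, IsMarkovChain μ X P ∧ (∀ m, IdentDistrib (X m) (X 0) μ μ) ∧
    ∃ c : ℝ, ∀ s t, (P * P) s t = c

/-- The hitting time `inf {m ≥ 0 : X_m ∈ F}`, equal to `∞` if `F` is never visited. -/
noncomputable def hitTime {Ω S : Type*} (X : ℕ → Ω → S) (F : Set S) : Ω → ℕ∞ :=
  hittingAfter X F 0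

/-! ### The game -/

section Game

variable {Ω : Type*} [MeasurableSpace Ω] {n : ℕ}

/-- Any two distinct members of the family are equal with probability zero. -/
def NoTie (μ : Measure Ω) (T : Fin n → Ω → ℕ∞) : Prop :=
  ∀ i j, i ≠ j → ∀ᵐ ω ∂μ, T i ω ≠ T j ω

/-- All members of the family have the same law. -/
def IdenticallyDistributed (μ : Measure Ω) (T : Fin n → Ω → ℕ∞) : Prop :=
  ∀ i j, IdentDistrib (T i) (T j) μ μ

/-- The earliest time `min {T i : i ∈ A}`. -/
noncomputable def minTime (T : Fin n → Ω → ℕ∞) (A : Finset (Fin n)) (ω : Ω) : ℕ∞ :=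
  A.inf fun i => T i ω

open Classical in
/-- The amount that Player I pays to Player II when the final choice is `(A', B')`:
if `min_{A'} T < min_{B'} T`, Player II pays `|B'|` to Player I, otherwise Player I pays
`|A'|` to Player II. -/
noncomputable def payoff (T : Fin n → Ω → ℕ∞) (A' B' : Finset (Fin n)) (ω : Ω) : ℝ :=
  if minTime T A' ω < minTime T B' ω then -(B'.card : ℝ) else (A'.card : ℝ)

/-- The expected payoff of Player II. -/
noncomputable def expectedPayoff (μ : Measure Ω) (T : Fin n → Ω → ℕ∞)
    (A' B' : Finset (Fin n)) : ℝ :=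
  ∫ ω, payoff T A' B' ω ∂μ

/-- First choice of Player I: a set of `r₁` indices. -/
abbrev FirstMove (n r₁ : ℕ) : Type :=
  {A : Finset (Fin n) // A.card = r₁}

/-- Reply of Player II: a set of `r₂` indices which is disjoint from `A`. -/
abbrev Reply (r₂ : ℕ) (A : Finset (Fin n)) : Type :=
  {B : Finset (Fin n) // B.card = r₂ ∧ Disjoint A B}

/-- Final choice of Player I: nonempty subsets `A' ⊆ A` and `B' ⊆ B`. -/
abbrev FinalMove (A B : Finset (Fin n)) : Type :=
  {C : Finset (Fin n) × Finset (Fin n) // (C.1.Nonempty ∧ C.1 ⊆ A) ∧ (C.2.Nonempty ∧ C.2 ⊆ B)}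

/-- The expected payoff of Player II when both players play optimally: Player I
minimises over `A`, then Player II maximises over `B`, then Player I minimises over `(A', B')`.
For `1 ≤ r₁`, `1 ≤ r₂` and `r₁ + r₂ ≤ n` every set of moves is finite and nonempty, so that all
infima and suprema are attained. -/
noncomputable def gameValue (μ : Measure Ω) (T : Fin n → Ω → ℕ∞) (r₁ r₂ : ℕ) : ℝ :=
  ⨅ A : FirstMove n r₁, ⨆ B : Reply r₂ A.1, ⨅ C : FinalMove A.1 B.1,
    expectedPayoff μ T C.1.1 C.1.2

/-- The game with parameters `r₁, r₂`, which is defined for `r₁ + r₂ ≤ n` only, is favorable to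
Player II. -/
def IsFavorable (μ : Measure Ω) (T : Fin n → Ω → ℕ∞) (r₁ r₂ : ℕ) : Prop :=
  r₁ + r₂ ≤ n ∧ 0 < gameValue μ T r₁ r₂

end Game

/-! ### Directional tournaments -/

/-- A tournament: no loops, and exactly one of the two arrows between distinct vertices. -/
def IsTournament {V : Type*} (G : Digraph V) : Prop :=
  (∀ v, ¬ G.Adj v v) ∧ ∀ u v, u ≠ v → Xor (G.Adj u v) (G.Adj v u)

/-- Every set `A` of `r₁` vertices has a disjoint set `B` of `r₂` vertices such that all arrows
from `A` to `B` are present. -/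
def IsDirectional {V : Type*} (G : Digraph V) (r₁ r₂ : ℕ) : Prop :=
  ∀ A : Finset V, A.card = r₁ →
    ∃ B : Finset V, B.card = r₂ ∧ Disjoint A B ∧ ∀ i ∈ A, ∀ j ∈ B, G.Adj i j

/-- The numbers `k ≥ r₁ + r₂` of vertices of `(r₁, r₂)`-directional tournaments. -/
def directionalOrders (r₁ r₂ : ℕ) : Set ℕ :=
  {k | r₁ + r₂ ≤ k ∧ ∃ G : Digraph (Fin k), IsTournament G ∧ IsDirectional G r₁ r₂}

/-- The least number of vertices, at least `r₁ + r₂`, of an `(r₁, r₂)`-directional tournament. -/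
noncomputable def threshold (r₁ r₂ : ℕ) : ℕ :=
  sInf (directionalOrders r₁ r₂)

end PenneyGame

open PenneyGame

/-! Necessity: testing a favorable game on singletons `A' = {i}`, `B' = {j}` shows `ℙ(T i < T j) <
ℙ(T j < T i)` for all `i ∈ A`, `j ∈ B`. Orienting `i → j` by this comparison, and by the order of
indices when the probabilities agree, gives a directional tournament on the hitting times.

Sufficiency: given a directional tournament `G`, take i.i.d. uniform letters from an alphabet of
size `q`, whose consecutive pairs form a 1-dependent uniform chain. Each arrow `i → j` receives a
cycle of three letters; the transition from the first to the second is labelled `j`, the one from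
the second to the third `i`. `T i` is the first time of a transition labelled `i`. Every label is
used `n - 1` times, and never twice in a row, so the `T i` have the same law
(`measureReal_avoiding_eq`).

Now stop at the first transition with label in `C = A' ∪ B'`. By `expectedVisits_next` a letter is
visited `κ` times on average, unless its predecessor has a label in `C`: arriving by that labelled
transition would have stopped the process, so visits are lost. Hence label `a ∈ C` stops the process
with probability `κ ((n - 1) - d(a) / q) / q`, where `d` is the out-degree inside `C`
(`sum_expectedVisits_arrowLabel`). The terms `n - 1` cancel in the payoff, leaving `κ / q ^ 2 *
(|B'| ∑_{A'} d - |A'| ∑_{B'} d)`. If all arrows go from `A'` to `B'`, the bracket is at least `|A'|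
|B'|`.

It remains to see that the admissible numbers of vertices are upward closed, by blowing up vertices
(`mem_directionalOrders_of_le`), and exist at all, by an explicit construction
(`exists_adj_columnDigraph`). -/

/-! ### Directional tournaments exist -/

section Tournaments

variable {V : Type*}

/-- If every set of at most `r₁ + r₂` vertices has a common out-neighbour, then common
out-neighbours can be added one at a time. -/
lemma isDirectional_of_forall_exists_adj {G : Digraph V} {r₁ r₂ : ℕ}
    (hG : ∀ v, ¬ G.Adj v v)
    (h : ∀ A : Finset V, A.card ≤ r₁ + r₂ → ∃ v, ∀ i ∈ A, G.Adj i v) :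
    IsDirectional G r₁ r₂ := by
  classical
  intro A hA
  suffices H : ∀ s ≤ r₂, ∃ B : Finset V, B.card = s ∧ Disjoint A B ∧
      ∀ i ∈ A, ∀ j ∈ B, G.Adj i j from H r₂ le_rfl
  intro s
  induction s with
  | zero => exact fun _ => ⟨∅, by simp⟩
  | succ s ih =>
    intro hs
    obtain ⟨B, hB, hAB, hadj⟩ := ih (by omega)
    obtain ⟨v, hv⟩ := h (A ∪ B) (by have := Finset.card_union_le A B; omega)
    have hvA : v ∉ A := fun hmem => hG v (hv v (Finset.mem_union_left _ hmem))
    have hvB : v ∉ B := fun hmem => hG v (hv v (Finset.mem_union_right _ hmem))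
    refine ⟨insert v B, by simp [hvB, hB], ?_, ?_⟩
    · rw [Finset.disjoint_insert_right]
      exact ⟨hvA, hAB⟩
    · intro i hi j hj
      rcases Finset.mem_insert.1 hj with rfl | hj
      · exact hv i (Finset.mem_union_left _ hi)
      · exact hadj i hi j hj

/-- Replace the vertices of a digraph by the fibres of `π`, each of them ordered linearly. -/
def blowUp {W : Type*} [LinearOrder W] (π : W → V) (G : Digraph V) : Digraph W where
  Adj x y := (π x = π y ∧ x < y) ∨ (π x ≠ π y ∧ G.Adj (π x) (π y))

lemma isTournament_blowUp {W : Type*} [LinearOrder W] (π : W → V) {G : Digraph V}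
    (hG : IsTournament G) : IsTournament (blowUp π G) := by
  refine ⟨fun v => by simp [blowUp], fun x y hxy => ?_⟩
  by_cases h : π x = π y
  · rcases lt_or_gt_of_ne hxy with hlt | hlt
    · simp [blowUp, h, hlt, hlt.not_gt, Xor]
    · simp [blowUp, h, hlt, hlt.not_gt, Xor]
  · simpa [blowUp, h, Ne.symm h, fun hh : π y = π x => h hh.symm] using hG.2 _ _ h

/-- Project `A` to `V`, find `B` there, and lift it by a section of `π`. Disjointness in `V` puts
the lifts in fibres not met by `A`, where the arrows are those of `G`. -/
lemma isDirectional_blowUp {W : Type*} [LinearOrder W] [Fintype V] {π : W → V}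
    (hπ : Function.Surjective π) {G : Digraph V} {r₁ r₂ : ℕ} (hr : r₁ ≤ Fintype.card V)
    (hG : IsDirectional G r₁ r₂) : IsDirectional (blowUp π G) r₁ r₂ := by
  classical
  intro A hA
  -- The projection may shrink `A`, so its image is padded to exactly `r₁` vertices.
  obtain ⟨A', hAA', hA'⟩ := Finset.exists_superset_card_eq (s := A.image π) (n := r₁)
    (hA ▸ Finset.card_image_le) hr
  obtain ⟨B, hB, hdisj, hadj⟩ := hG A' hA'
  obtain ⟨σ, hσ⟩ := hπ.hasRightInverse
  have hA'' : ∀ i ∈ A, π i ∈ A' := fun i hi => hAA' (Finset.mem_image_of_mem _ hi)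
  refine ⟨B.image σ, by rw [Finset.card_image_of_injective _ hσ.injective, hB], ?_, ?_⟩
  · rw [Finset.disjoint_left]
    intro i hi hi'
    obtain ⟨b, hb, rfl⟩ := Finset.mem_image.1 hi'
    exact Finset.disjoint_left.1 hdisj (hA'' _ hi) (by rwa [hσ b])
  · intro i hi j hj
    obtain ⟨b, hb, rfl⟩ := Finset.mem_image.1 hj
    refine Or.inr ⟨fun h => ?_, ?_⟩
    · exact Finset.disjoint_left.1 hdisj (hA'' _ hi) (by rwa [h, hσ b])
    · rw [hσ b]
      exact hadj _ (hA'' _ hi) _ hb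

/-- Vertices of the column tournament: `m + 1` columns, and in each of them the functions which
attach to every column an `m`-tuple of labels and a label, out of `m ^ 2 + 1` labels. -/
abbrev ColumnVertex (m : ℕ) : Type :=
  Fin (m + 1) × (Fin (m + 1) → (Fin m → Fin (m ^ 2 + 1)) × Fin (m ^ 2 + 1))

/-- For columns `i < j` there is an arrow `(j, g) → (i, f)` if the label of `g` at `i` belongs to
the tuple of `f` at `j`, and an arrow `(i, f) → (j, g)` otherwise. -/
def columnDigraph (m : ℕ) : Digraph (ColumnVertex m) where
  Adj x y :=
    (y.1 < x.1 ∧ (x.2 y.1).2 ∈ Set.range (y.2 x.1).1) ∨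
    (x.1 < y.1 ∧ (y.2 x.1).2 ∉ Set.range (x.2 y.1).1) ∨
    (x.1 = y.1 ∧ Fintype.equivFin _ x < Fintype.equivFin _ y)

lemma isTournament_columnDigraph (m : ℕ) : IsTournament (columnDigraph m) := by
  refine ⟨fun v => by simp [columnDigraph], fun x y hxy => ?_⟩
  have hne : Fintype.equivFin _ x ≠ Fintype.equivFin _ y := fun h => hxy (Equiv.injective _ h)
  rcases lt_trichotomy x.1 y.1 with h | h | h
  · by_cases h' : (y.2 x.1).2 ∈ Set.range (x.2 y.1).1 <;>
      simp only [columnDigraph, Xor, h, h', h.not_gt, h.ne, h.ne'] <;> simp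
  · rcases lt_or_gt_of_ne hne with h' | h' <;>
      simp only [columnDigraph, Xor, h, h', h'.not_gt, lt_irrefl] <;> simp
  · by_cases h' : (x.2 y.1).2 ∈ Set.range (y.2 x.1).1 <;>
      simp only [columnDigraph, Xor, h, h', h.not_gt, h.ne, h.ne'] <;> simp

/-- At most `m` vertices miss one of the `m + 1` columns, say `i`. In column `i` the tuple and the
label can be chosen freely: a tuple listing all labels of `A` at `i` serves the columns after `i`, a
label outside all tuples of `A` at `i` serves those before. -/
lemma exists_adj_columnDigraph (m : ℕ) (A : Finset (ColumnVertex m)) (hA : A.card ≤ m) :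
    ∃ v, ∀ x ∈ A, (columnDigraph m).Adj x v := by
  classical
  obtain ⟨i, hi⟩ : ∃ i, i ∉ A.image Prod.fst := by
    by_contra! h
    have h1 := Finset.card_le_card (fun i _ => h i : Finset.univ ⊆ A.image Prod.fst)
    have h2 : (A.image Prod.fst).card ≤ A.card := Finset.card_image_le
    simp at h1
    omega
  obtain ⟨t, ht⟩ : ∃ t : Fin m → Fin (m ^ 2 + 1), ∀ x ∈ A, (x.2 i).2 ∈ Set.range t := by
    rcases A.eq_empty_or_nonempty with rfl | ⟨x₀, hx₀⟩
    · exact ⟨fun _ => 0, by simp⟩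
    have : Nonempty A := ⟨⟨x₀, hx₀⟩⟩
    obtain ⟨f⟩ : Nonempty (A ↪ Fin m) :=
      Function.Embedding.nonempty_of_card_le (by simpa using hA)
    refine ⟨fun k => ((Function.invFun f k : A).1.2 i).2, fun x hx => ⟨f ⟨x, hx⟩, ?_⟩⟩
    simp only [Function.leftInverse_invFun f.injective _]
  -- At most `m` tuples of length `m` cover at most `m ^ 2` labels, so one of the `m ^ 2 + 1` is
  -- free.
  obtain ⟨l, hl⟩ : ∃ l : Fin (m ^ 2 + 1), ∀ x ∈ A, l ∉ Set.range (x.2 i).1 := by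
    by_contra! h
    have h1 : (Finset.univ : Finset (Fin (m ^ 2 + 1))) ⊆
        A.biUnion fun x => Finset.univ.image (x.2 i).1 := by
      intro l _
      obtain ⟨x, hx, k, hk⟩ := h l
      exact Finset.mem_biUnion.2 ⟨x, hx, Finset.mem_image.2 ⟨k, Finset.mem_univ _, hk⟩⟩
    have h2 := Finset.card_le_card h1
    have h3 : (A.biUnion fun x => Finset.univ.image (x.2 i).1).card ≤ A.card * m :=
      Finset.card_biUnion_le_card_mul _ _ _ fun x _ => by
        simpa using Finset.card_image_le (s := (Finset.univ : Finset (Fin m))) (f := (x.2 i).1)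
    have h4 : A.card * m ≤ m * m := Nat.mul_le_mul_right m hA
    simp [sq] at h2
    omega
  refine ⟨(i, fun _ => (t, l)), fun x hx => ?_⟩
  have hxi : x.1 ≠ i := fun h => hi (h ▸ Finset.mem_image_of_mem _ hx)
  rcases lt_or_gt_of_ne hxi with h | h
  · exact Or.inr (Or.inl ⟨h, hl x hx⟩)
  · exact Or.inl ⟨h, ht x hx⟩

end Tournaments

/-- Blow up the last vertex of the smaller tournament: `x ↦ min x (k - 1)` maps `Fin n` onto `Fin
k`. -/
lemma mem_directionalOrders_of_le {r₁ r₂ k n : ℕ} (hr : 1 ≤ r₁)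
    (hk : k ∈ directionalOrders r₁ r₂) (hkn : k ≤ n) : n ∈ directionalOrders r₁ r₂ := by
  obtain ⟨hle, G, hT, hD⟩ := hk
  have hk0 : 0 < k := by omega
  refine ⟨hle.trans hkn, blowUp (fun x : Fin n => (⟨min x (k - 1), by omega⟩ : Fin k)) G,
    isTournament_blowUp _ hT, isDirectional_blowUp (fun y => ⟨⟨y, by omega⟩, ?_⟩)
      (by simp; omega) hD⟩
  ext
  simp
  omega

theorem directionalOrders_nonempty (r₁ r₂ : ℕ) : (directionalOrders r₁ r₂).Nonempty := by
  classical
  let m := r₁ + r₂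
  have hcard : m ≤ Fintype.card (ColumnVertex m) := by
    have := Fintype.card_le_of_surjective (Prod.fst : ColumnVertex m → Fin (m + 1))
      Prod.fst_surjective
    rw [Fintype.card_fin] at this
    exact (Nat.le_succ m).trans this
  refine ⟨Fintype.card (ColumnVertex m), hcard,
    -- Blowing up along a bijection merely renames the vertices.
    blowUp (Fintype.equivFin (ColumnVertex m)).symm (columnDigraph m),
    isTournament_blowUp _ (isTournament_columnDigraph m),
    isDirectional_blowUp (Equiv.surjective _) ((Nat.le_add_right r₁ r₂).trans hcard) ?_⟩
  exact isDirectional_of_forall_exists_adj (isTournament_columnDigraph m).1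
    fun A hA => exists_adj_columnDigraph m A hA

/-! ### Values of the game -/

section Game

variable {Ω : Type*} [MeasurableSpace Ω] {n : ℕ}

lemma gameValue_pos_iff (μ : Measure Ω) (T : Fin n → Ω → ℕ∞) {r₁ r₂ : ℕ}
    (hr₁ : 1 ≤ r₁) (hr₂ : 1 ≤ r₂) (hn : r₁ + r₂ ≤ n) :
    0 < gameValue μ T r₁ r₂ ↔ ∀ A : Finset (Fin n), A.card = r₁ →
      ∃ B : Finset (Fin n), B.card = r₂ ∧ Disjoint A B ∧
        ∀ A' B' : Finset (Fin n), A'.Nonempty → A' ⊆ A → B'.Nonempty → B' ⊆ B →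
          0 < expectedPayoff μ T A' B' := by
  have iInf_pos : ∀ {ι : Type} [Finite ι] [Nonempty ι] (f : ι → ℝ),
      0 < ⨅ i, f i ↔ ∀ i, 0 < f i := by
    intro ι _ _ f
    refine ⟨fun h i => h.trans_le (ciInf_le (Set.finite_range f).bddBelow i), fun h => ?_⟩
    obtain ⟨i, hi⟩ := exists_eq_ciInf_of_finite (f := f)
    exact hi ▸ h i
  have iSup_pos : ∀ {ι : Type} [Finite ι] [Nonempty ι] (f : ι → ℝ),
      0 < ⨆ i, f i ↔ ∃ i, 0 < f i := by
    intro ι _ _ f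
    refine ⟨fun h => exists_lt_of_lt_ciSup h, fun ⟨i, hi⟩ => ?_⟩
    exact hi.trans_le (le_ciSup (Set.finite_range f).bddAbove i)
  -- In `ℝ` the infimum and supremum over an empty type are `0`, so nonempty move sets are needed to
  -- pass between positivity of the value and quantifiers over moves.
  have : Nonempty (FirstMove n r₁) := by
    obtain ⟨A, -, hA⟩ := Finset.exists_subset_card_eq (s := (Finset.univ : Finset (Fin n)))
      (n := r₁) (by simp; omega)
    exact ⟨⟨A, hA⟩⟩
  have hB : ∀ A : FirstMove n r₁, Nonempty (Reply r₂ A.1) := by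
    intro A
    obtain ⟨B, hBA, hB⟩ := Finset.exists_subset_card_eq (s := A.1ᶜ)
      (n := r₂) (by rw [Finset.card_compl, A.2]; simp; omega)
    exact ⟨⟨B, hB, (Finset.subset_compl_iff_disjoint_left).1 hBA⟩⟩
  have hC : ∀ (A : FirstMove n r₁) (B : Reply r₂ A.1), Nonempty (FinalMove A.1 B.1) := by
    intro A B
    exact ⟨⟨(A.1, B.1), ⟨Finset.card_pos.1 (by rw [A.2]; omega), subset_rfl⟩,
      Finset.card_pos.1 (by rw [B.2.1]; omega), subset_rfl⟩⟩
  rw [gameValue, iInf_pos]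
  constructor
  · intro h A hA
    obtain ⟨B, hB⟩ := (iSup_pos _).1 (h ⟨A, hA⟩)
    exact ⟨B.1, B.2.1, B.2.2, fun A' B' h1 h2 h3 h4 =>
      (iInf_pos _).1 hB ⟨(A', B'), ⟨h1, h2⟩, h3, h4⟩⟩
  · intro h A
    obtain ⟨B, hB, hAB, hpos⟩ := h A.1 A.2
    exact (iSup_pos _).2 ⟨⟨B, hB, hAB⟩, (iInf_pos _).2 fun C =>
      hpos _ _ C.2.1.1 C.2.1.2 C.2.2.1 C.2.2.2⟩

/-- The expected payoff in terms of the winning probability of Player I. -/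
lemma expectedPayoff_eq (μ : Measure Ω) [IsProbabilityMeasure μ] (T : Fin n → Ω → ℕ∞)
    (hT : ∀ i, AEMeasurable (T i) μ) (A B : Finset (Fin n)) :
    expectedPayoff μ T A B =
      A.card * (1 - μ.real {ω | minTime T A ω < minTime T B ω}) -
        B.card * μ.real {ω | minTime T A ω < minTime T B ω} := by
  classical
  have hmin : ∀ C : Finset (Fin n), AEMeasurable (minTime T C) μ := by
    intro C
    have : minTime T C = (fun x : Fin n → ℕ∞ => C.inf x) ∘ fun ω i => T i ω := rfl
    rw [this]
    -- `Fin n → ℕ∞` is countable, so every function on it is measurable.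
    exact (measurable_of_countable _).comp_aemeasurable (aemeasurable_pi_lambda _ hT)
  have hset : NullMeasurableSet {ω | minTime T A ω < minTime T B ω} μ := by
    have : {ω | minTime T A ω < minTime T B ω} =
        (fun ω => (minTime T A ω, minTime T B ω)) ⁻¹' {x | x.1 < x.2} := rfl
    rw [this]
    exact ((hmin A).prodMk (hmin B)).nullMeasurableSet_preimage (Set.to_countable _).measurableSet
  set E := {ω | minTime T A ω < minTime T B ω} with hE
  have hpay : payoff T A B =
      fun ω => (A.card : ℝ) - E.indicator (fun _ => (A.card + B.card : ℝ)) ω := by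
    ext ω
    by_cases h : minTime T A ω < minTime T B ω
    · simp [payoff, hE, h]
    · simp [payoff, hE, h]
  rw [expectedPayoff, hpay, integral_sub (integrable_const _)
    ((integrable_const _).indicator₀ hset), integral_indicator₀ hset]
  simp
  ring

/-- A favorable game yields a directional tournament on the set of hitting times. -/
theorem mem_directionalOrders_of_isFavorable (μ : Measure Ω) [IsProbabilityMeasure μ]
    (T : Fin n → Ω → ℕ∞) (hT : ∀ i, AEMeasurable (T i) μ) (hnt : NoTie μ T) {r₁ r₂ : ℕ}
    (hr₁ : 1 ≤ r₁) (hr₂ : 1 ≤ r₂) (hfav : IsFavorable μ T r₁ r₂) :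
    n ∈ directionalOrders r₁ r₂ := by
  let p : Fin n → Fin n → ℝ := fun i j => μ.real {ω | T i ω < T j ω}
  refine ⟨hfav.1, ⟨fun i j => p i j < p j i ∨ (p i j = p j i ∧ i < j)⟩,
    ⟨fun i => by simp, fun i j hij => ?_⟩, fun A hA => ?_⟩
  · rcases lt_trichotomy (p i j) (p j i) with h | h | h
    · simp [Xor, h, h.not_gt, h.ne']
    · rcases lt_or_gt_of_ne hij with h' | h' <;> simp [Xor, h, h', h'.not_gt]
    · simp [Xor, h, h.not_gt, h.ne']
  obtain ⟨B, hB, hAB, hpos⟩ := (gameValue_pos_iff μ T hr₁ hr₂ hfav.1).1 hfav.2 A hA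
  refine ⟨B, hB, hAB, fun i hi j hj => Or.inl ?_⟩
  have hij : i ≠ j := fun h => Finset.disjoint_left.1 hAB hi (h ▸ hj)
  have h1 := hpos {i} {j} (by simp) (by simpa) (by simp) (by simpa)
  rw [expectedPayoff_eq μ T hT] at h1
  simp only [minTime, Finset.inf_singleton, Finset.card_singleton, Nat.cast_one, one_mul] at h1
  -- Without ties one of the two strict inequalities holds almost surely. Together with `h1`, which
  -- says `p i j < 1 / 2`, this gives `p i j < p j i`.
  have h2 : (1 : ℝ) ≤ p i j + p j i := by
    have h3 : μ.real ({ω | T i ω < T j ω} ∪ {ω | T j ω < T i ω}) = μ.real Set.univ := by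
      refine measureReal_congr ?_
      filter_upwards [hnt i j hij] with ω hω
      exact propext ⟨fun _ => trivial, fun _ => lt_or_gt_of_ne hω⟩
    rw [probReal_univ] at h3
    exact h3 ▸ measureReal_union_le _ _
  have h4 : p i j = μ.real {ω | T i ω < T j ω} := rfl
  linarith

end Game

/-! ### Sequences of independent uniform letters -/

section Sequences

variable {W : Type u}

/-- A set of sequences which depends only on the letters up to time `m`. -/
def DependsOnUpTo (m : ℕ) (D : Set (ℕ → W)) : Prop :=
  ∀ ω ω' : ℕ → W, (∀ k ≤ m, ω k = ω' k) → ω ∈ D → ω' ∈ D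

/-- Being the preimage of a set of finite words makes `D` measurable for finite `W`, and independent
of later letters. -/
lemma DependsOnUpTo.eq_preimage {m : ℕ} {D : Set (ℕ → W)} (hD : DependsOnUpTo m D) :
    D = (fun ω (i : Finset.range (m + 1)) => ω i) ⁻¹'
      ((fun ω (i : Finset.range (m + 1)) => ω i) '' D) := by
  refine (Set.subset_preimage_image _ _).antisymm ?_
  rintro ω ⟨ω', hω', h⟩
  refine hD ω' ω (fun k hk => ?_) hω'
  exact congrFun h ⟨k, Finset.mem_range.2 (by omega)⟩

/-- The sequences without a transition of type `E` before time `m`. -/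
def avoiding (E : W → W → Prop) (m : ℕ) : Set (ℕ → W) :=
  {ω | ∀ k < m, ¬ E (ω k) (ω (k + 1))}

lemma dependsOnUpTo_avoiding (E : W → W → Prop) (m : ℕ) : DependsOnUpTo m (avoiding E m) := by
  intro ω ω' h hω k hk
  rw [← h k hk.le, ← h (k + 1) hk]
  exact hω k hk

lemma avoiding_zero (E : W → W → Prop) : avoiding E 0 = Set.univ := by
  ext; simp [avoiding]

lemma avoiding_succ (E : W → W → Prop) (m : ℕ) :
    avoiding E (m + 1) = avoiding E m ∩ {ω | ¬ E (ω m) (ω (m + 1))} := by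
  ext ω
  simp only [avoiding, Set.mem_ofPred_eq, Set.mem_inter_iff, Nat.forall_lt_succ_right]

end Sequences

section Iid

set_option linter.unusedSectionVars false

variable {W : Type u} [Fintype W] [Nonempty W] [MeasurableSpace W] [DiscreteMeasurableSpace W]

/-- The law of a sequence of independent uniform random elements of `W`. -/
noncomputable def iidUniform (W : Type u) [Fintype W] [Nonempty W] [MeasurableSpace W] :
    Measure (ℕ → W) :=
  Measure.infinitePi fun _ => (PMF.uniformOfFintype W).toMeasure

noncomputable instance : IsProbabilityMeasure (iidUniform W) := by
  unfold iidUniform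
  infer_instance

lemma measurableSet_eval_eq (m : ℕ) (y : W) : MeasurableSet {ω : ℕ → W | ω m = y} :=
  measurable_pi_apply (X := fun _ : ℕ => W) m (measurableSet_singleton y)

lemma iidUniform_eval (m : ℕ) (y : W) :
    (iidUniform W).real {ω | ω m = y} = (Fintype.card W : ℝ)⁻¹ := by
  have h : (iidUniform W).map (fun ω => ω m) = (PMF.uniformOfFintype W).toMeasure :=
    Measure.infinitePi_map_eval _ m
  have h2 : {ω : ℕ → W | ω m = y} = (fun ω => ω m) ⁻¹' {y} := rfl
  rw [h2, measureReal_def, ← Measure.map_apply (measurable_pi_apply m) (measurableSet_singleton y),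
    h, PMF.toMeasure_apply_singleton _ _ (measurableSet_singleton y)]
  simp

lemma DependsOnUpTo.measurableSet {m : ℕ} {D : Set (ℕ → W)} (hD : DependsOnUpTo m D) :
    MeasurableSet D := by
  rw [hD.eq_preimage]
  exact measurable_pi_lambda _ (fun i => measurable_pi_apply _) (Set.toFinite _).measurableSet

lemma DependsOnUpTo.measureReal_inter {m : ℕ} {D : Set (ℕ → W)} (hD : DependsOnUpTo m D)
    (z : W) :
    (iidUniform W).real (D ∩ {ω | ω (m + 1) = z}) =
      (iidUniform W).real D / Fintype.card W := by
  have hind : iIndepFun (fun (i : ℕ) (ω : ℕ → W) => ω i) (iidUniform W) :=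
    iIndepFun_infinitePi (P := fun _ : ℕ => (PMF.uniformOfFintype W).toMeasure)
      (X := fun _ => id) (fun _ => measurable_id)
  have h := hind.indepFun_finset (Finset.range (m + 1)) {m + 1} (by simp)
    (fun i => measurable_pi_apply i)
  have hz : {ω : ℕ → W | ω (m + 1) = z} =
      (fun ω (i : ({m + 1} : Finset ℕ)) => ω i) ⁻¹' {x | x ⟨m + 1, by simp⟩ = z} := rfl
  have h2 := h.measure_inter_preimage_eq_mul
    ((fun ω (i : Finset.range (m + 1)) => ω i) '' D) {x | x ⟨m + 1, by simp⟩ = z}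
    (Set.toFinite _).measurableSet (Set.toFinite _).measurableSet
  rw [← hD.eq_preimage, ← hz] at h2
  rw [measureReal_def, h2, ENNReal.toReal_mul, ← measureReal_def, ← measureReal_def,
    iidUniform_eval, div_eq_mul_inv]

lemma iidUniform_sum_inter {D : Set (ℕ → W)} (m : ℕ) :
    ∑ y, (iidUniform W).real (D ∩ {ω | ω m = y}) = (iidUniform W).real D := by
  have hD : ∀ y : W, (iidUniform W).real (D ∩ {ω | ω m = y}) =
      ((iidUniform W).restrict D).real {ω | ω m = y} := fun y => by
    rw [measureReal_restrict_apply (measurableSet_eval_eq m y),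
      Set.inter_comm]
  simp_rw [hD]
  rw [← measureReal_biUnion_finset]
  · have : (⋃ y ∈ (Finset.univ : Finset W), {ω : ℕ → W | ω m = y}) = Set.univ := by
      ext ω
      simp
    rw [this, measureReal_restrict_apply_univ]
  · intro y _ z _ hyz
    exact Set.disjoint_left.2 fun ω h1 h2 => hyz (h1.symm.trans h2)
  · exact fun y _ => measurableSet_eval_eq m y

/-- The probability to be at `y` at time `m` without a transition of type `E` before. -/
noncomputable def visitProb (E : W → W → Prop) (m : ℕ) (y : W) : ℝ :=
  (iidUniform W).real (avoiding E m ∩ {ω | ω m = y})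

lemma visitProb_nonneg (E : W → W → Prop) (m : ℕ) (y : W) : 0 ≤ visitProb E m y :=
  measureReal_nonneg

lemma sum_visitProb (E : W → W → Prop) (m : ℕ) :
    ∑ y, visitProb E m y = (iidUniform W).real (avoiding E m) :=
  iidUniform_sum_inter m

lemma visitProb_zero (E : W → W → Prop) (y : W) :
    visitProb E 0 y = (Fintype.card W : ℝ)⁻¹ := by
  rw [visitProb, avoiding_zero, Set.univ_inter, iidUniform_eval]

lemma dependsOnUpTo_avoiding_inter (E : W → W → Prop) (m : ℕ) (y : W) :
    DependsOnUpTo m (avoiding E m ∩ {ω | ω m = y}) := fun ω ω' h hω =>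
  ⟨dependsOnUpTo_avoiding E m ω ω' h hω.1, (h m le_rfl).symm.trans hω.2⟩

open Classical in
/-- A step of type `E'` at time `m`, without a transition of type `E` before. -/
lemma measureReal_avoiding_inter_step (E E' : W → W → Prop) (m : ℕ) (z : W) :
    (iidUniform W).real (avoiding E m ∩ {ω | E' (ω m) (ω (m + 1))} ∩ {ω | ω (m + 1) = z}) =
      (∑ y, if E' y z then visitProb E m y else 0) / Fintype.card W := by
  rw [← iidUniform_sum_inter m, Finset.sum_div]
  refine Finset.sum_congr rfl fun y _ => ?_
  split_ifs with h
  · rw [visitProb, ← (dependsOnUpTo_avoiding_inter E m y).measureReal_inter z]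
    congr 1
    ext ω
    simp only [Set.mem_inter_iff, Set.mem_ofPred_eq]
    constructor
    · rintro ⟨⟨⟨h1, -⟩, h2⟩, h3⟩
      exact ⟨⟨h1, h3⟩, h2⟩
    · rintro ⟨⟨h1, h3⟩, h2⟩
      exact ⟨⟨⟨h1, by rwa [h2, h3]⟩, h2⟩, h3⟩
  · rw [zero_div]
    convert measureReal_empty
    ext ω
    simp only [Set.mem_inter_iff, Set.mem_ofPred_eq, Set.mem_empty_iff_false, iff_false]
    rintro ⟨⟨⟨h1, h4⟩, h2⟩, h3⟩
    exact h (h3 ▸ h2 ▸ h4)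

-- The letter at time `m + 1` is uniform and independent of the past, so every surviving path
-- reaches `z` with probability `1 / |W|`, except those for which this step has type `E`.
open Classical in
lemma visitProb_succ (E : W → W → Prop) (m : ℕ) (z : W) :
    visitProb E (m + 1) z =
      ((iidUniform W).real (avoiding E m) - ∑ y, if E y z then visitProb E m y else 0) /
        Fintype.card W := by
  rw [visitProb, avoiding_succ, measureReal_avoiding_inter_step E (fun y z => ¬ E y z),
    ← sum_visitProb, ← Finset.sum_sub_distrib]
  congr 1
  refine Finset.sum_congr rfl fun y _ => ?_
  by_cases h : E y z <;> simp [h]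

/-- The probability of a step of type `E'` at time `m`, without a transition of type `E` before. -/
noncomputable def stepProb (E E' : W → W → Prop) (m : ℕ) : ℝ :=
  (iidUniform W).real (avoiding E m ∩ {ω | E' (ω m) (ω (m + 1))})

open Classical in
lemma stepProb_eq (E E' : W → W → Prop) (m : ℕ) :
    stepProb E E' m =
      (∑ z, ∑ y, if E' y z then visitProb E m y else 0) / Fintype.card W := by
  rw [stepProb, ← iidUniform_sum_inter (m + 1), Finset.sum_div]
  exact Finset.sum_congr rfl fun z _ => measureReal_avoiding_inter_step E E' m z

lemma measureReal_avoiding_succ (E : W → W → Prop) (m : ℕ) :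
    (iidUniform W).real (avoiding E (m + 1)) =
      (iidUniform W).real (avoiding E m) - stepProb E E m := by
  have h : MeasurableSet {ω : ℕ → W | E (ω m) (ω (m + 1))} :=
    DependsOnUpTo.measurableSet (m := m + 1) fun ω ω' h hω => by
      simpa only [Set.mem_ofPred_eq, ← h m (by omega), ← h (m + 1) le_rfl] using hω
  have h2 := measureReal_inter_add_sdiff (μ := iidUniform W) (s := avoiding E m) h
  have h3 : avoiding E m \ {ω : ℕ → W | E (ω m) (ω (m + 1))} = avoiding E (m + 1) := by
    rw [avoiding_succ]
    rfl
  rw [h3] at h2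
  rw [stepProb]
  linarith

end Iid

/-! ### The chain of pairs of consecutive letters -/

section PairChain

set_option linter.unusedSectionVars false

variable {W : Type u} [Fintype W] [Nonempty W] [MeasurableSpace W] [DiscreteMeasurableSpace W]
  {S : Type v} [Fintype S] [MeasurableSpace S] [DiscreteMeasurableSpace S]

/-- The process of the pairs of consecutive letters, with states labelled by `S`. -/
def pairChain (e : W × W ≃ S) (m : ℕ) (ω : ℕ → W) : S := e (ω m, ω (m + 1))

lemma measurable_pairChain (e : W × W ≃ S) (m : ℕ) : Measurable (pairChain e m) :=
  (measurable_of_finite e).comp ((measurable_pi_apply m).prodMk (measurable_pi_apply (m + 1)))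

-- From `(x, y)` the chain moves to `(y, z)` with `z` uniform. After two steps both letters are
-- fresh, so all entries of the squared matrix are `q⁻²`.
open Classical in
theorem isOneDependentUniformChain_pairChain (e : W × W ≃ S) :
    IsOneDependentUniformChain (iidUniform W) (pairChain e) := by
  have hq : (Fintype.card W : ℝ) ≠ 0 := by simp
  refine ⟨Matrix.of fun s t => if (e.symm s).2 = (e.symm t).1 then (Fintype.card W : ℝ)⁻¹ else 0,
    ⟨⟨fun s t => by rw [Matrix.of_apply]; positivity, fun s => ?_⟩, measurable_pairChain e, fun m x => ?_⟩,
    fun m => ⟨(measurable_pairChain e m).aemeasurable, (measurable_pairChain e 0).aemeasurable,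
      ?_⟩, ((Fintype.card W : ℝ)⁻¹) ^ 2, fun s t => ?_⟩
  · rw [← e.sum_comp, Fintype.sum_prod_type]
    simp [hq]
  · induction m with
    | zero => simp
    | succ m ih =>
      rw [Finset.prod_range_succ, ← mul_assoc, ← ih]
      have hdep : DependsOnUpTo (m + 1) {ω : ℕ → W | ∀ i ≤ m, pairChain e i ω = x i} := by
        intro ω ω' h hω i hi
        rw [← hω i hi, pairChain, pairChain, h i (by omega), h (i + 1) (by omega)]
      rw [Matrix.of_apply]
      split_ifs with h
      · rw [← div_eq_mul_inv, ← hdep.measureReal_inter (e.symm (x (m + 1))).2]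
        congr 1
        ext ω
        simp only [Set.mem_ofPred_eq, Set.mem_inter_iff, Nat.le_succ_iff, or_imp, forall_and,
          forall_eq]
        refine and_congr_right fun hω => ?_
        have h1 := hω m le_rfl
        rw [pairChain, ← Equiv.eq_symm_apply] at h1 ⊢
        rw [Prod.ext_iff] at h1 ⊢
        exact (and_iff_right (h1.2.trans h))
      · rw [mul_zero]
        convert measureReal_empty
        ext ω
        simp only [Set.mem_ofPred_eq, Set.mem_empty_iff_false, iff_false]
        intro hω
        have h1 := hω m (by omega)
        have h2 := hω (m + 1) le_rfl
        rw [pairChain, ← Equiv.eq_symm_apply] at h1 h2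
        rw [← h1, ← h2] at h
        exact h rfl
  · refine Measure.ext_of_singleton fun s => ?_
    have key : ∀ k, (iidUniform W).real (pairChain e k ⁻¹' {s}) =
        (Fintype.card W : ℝ)⁻¹ / Fintype.card W := by
      intro k
      have hdep : DependsOnUpTo k {ω : ℕ → W | ω k = (e.symm s).1} := fun ω ω' h hω =>
        (h k le_rfl).symm.trans hω
      rw [← iidUniform_eval k (e.symm s).1, ← hdep.measureReal_inter (e.symm s).2]
      congr 1
      ext ω
      simp [pairChain, ← Equiv.eq_symm_apply, Prod.ext_iff]
    rw [Measure.map_apply (measurable_pairChain e m) (measurableSet_singleton s),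
      Measure.map_apply (measurable_pairChain e 0) (measurableSet_singleton s),
      ← measureReal_eq_measureReal_iff, key, key]
  · rw [Matrix.mul_apply, ← e.sum_comp, Fintype.sum_prod_type]
    simp [sq]

lemma hitTime_ge_iff {Ω : Type*} {S : Type*} (X : ℕ → Ω → S) (F : Set S) (m : ℕ) (ω : Ω) :
    (m : ℕ∞) ≤ hitTime X F ω ↔ ∀ k < m, X k ω ∉ F := by
  constructor
  · intro h k hk
    exact notMem_of_lt_hittingAfter (n := 0)
      (lt_of_lt_of_le (by exact_mod_cast hk) h : (k : ℕ∞) < hittingAfter X F 0 ω) (Nat.zero_le k)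
  · intro h
    by_contra! hlt
    rw [hitTime, hittingAfter] at hlt
    split_ifs at hlt with hex
    · have hmem := Nat.sInf_mem (s := {i | 0 ≤ i ∧ X i ω ∈ F}) hex
      exact h _ (ENat.natCast_lt_natCast.1 hlt) hmem.2
    · exact absurd hlt (not_lt.2 le_top)

end PairChain

/-! ### Transitions along a permutation -/

section Marked

/-- Transitions `y → next y` from marked letters `y`. -/
def markedStep {W : Type u} (next : Equiv.Perm W) (P : W → Prop) (y z : W) : Prop :=
  z = next y ∧ P y

set_option linter.unusedSectionVars false

variable {W : Type u} [Fintype W] [Nonempty W] [MeasurableSpace W] [DiscreteMeasurableSpace W]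
  (next : Equiv.Perm W)

-- Since `next` is injective, `y` is the only letter from which the step to `next y` can be
-- forbidden.
open Classical in
lemma visitProb_markedStep_succ (P : W → Prop) (m : ℕ) (y : W) :
    visitProb (markedStep next P) (m + 1) (next y) =
      ((iidUniform W).real (avoiding (markedStep next P) m) -
        if P y then visitProb (markedStep next P) m y else 0) / Fintype.card W := by
  rw [visitProb_succ, Finset.sum_eq_single y]
  · simp [markedStep]
  · intro z _ hz
    simp [markedStep, hz.symm]
  · simp

open Classical in
lemma stepProb_markedStep (P P' : W → Prop) (m : ℕ) :
    stepProb (markedStep next P) (markedStep next P') m =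
      (∑ y, if P' y then visitProb (markedStep next P) m y else 0) / Fintype.card W := by
  rw [stepProb_eq, Finset.sum_comm]
  congr 1
  refine Finset.sum_congr rfl fun y _ => ?_
  rw [Finset.sum_eq_single (next y)]
  · simp [markedStep]
  · intro z _ hz
    simp [markedStep, hz]
  · simp

lemma stepProb_nonneg (E E' : W → W → Prop) (m : ℕ) : 0 ≤ stepProb E E' m :=
  measureReal_nonneg

lemma sum_range_stepProb (E : W → W → Prop) (M : ℕ) :
    ∑ m ∈ Finset.range M, stepProb E E m = 1 - (iidUniform W).real (avoiding E M) := by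
  induction M with
  | zero => simp [avoiding_zero]
  | succ M ih =>
    rw [Finset.sum_range_succ, ih, measureReal_avoiding_succ]
    ring

lemma summable_stepProb (E : W → W → Prop) : Summable (stepProb E E) := by
  refine summable_of_sum_range_le (c := 1) (stepProb_nonneg E E) fun M => ?_
  rw [sum_range_stepProb]
  linarith [measureReal_nonneg (μ := iidUniform W) (s := avoiding E M)]

variable {P : W → Prop}

-- Visits of a marked letter are summable, because each ends the process with probability `1 / |W|`
-- and the stopping probabilities sum to at most `1`. Solving the recursion at a marked letter for
-- the survival probability expresses it through such visits.
open Classical in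
lemma summable_measureReal_avoiding (hP : ∃ y, P y) :
    Summable fun m => (iidUniform W).real (avoiding (markedStep next P) m) := by
  have hq : (0 : ℝ) < Fintype.card W := by exact_mod_cast Fintype.card_pos
  have hv : ∀ y, P y → Summable fun m => visitProb (markedStep next P) m y := by
    intro y hy
    refine Summable.of_nonneg_of_le (fun m => visitProb_nonneg _ m y) (fun m => ?_)
      ((summable_stepProb (markedStep next P)).mul_left (Fintype.card W : ℝ))
    rw [stepProb_markedStep, mul_div_cancel₀ _ hq.ne']
    refine le_trans ?_ (Finset.single_le_sum (fun z _ => ?_) (Finset.mem_univ y))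
    · rw [if_pos hy]
    · split_ifs
      · exact visitProb_nonneg _ m z
      · exact le_rfl
  obtain ⟨y, hy⟩ := hP
  have h1 : ∀ m, (iidUniform W).real (avoiding (markedStep next P) m) =
      Fintype.card W * visitProb (markedStep next P) (m + 1) y +
        if P (next.symm y) then visitProb (markedStep next P) m (next.symm y) else 0 := by
    intro m
    have h := visitProb_markedStep_succ next P m (next.symm y)
    rw [Equiv.apply_symm_apply, eq_div_iff hq.ne'] at h
    linarith
  simp_rw [h1]
  refine (((summable_nat_add_iff 1).2 (hv y hy)).mul_left _).add ?_
  split_ifs with h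
  · exact hv _ h
  · exact summable_zero

lemma summable_visitProb (hP : ∃ y, P y) (y : W) :
    Summable fun m => visitProb (markedStep next P) m y :=
  Summable.of_nonneg_of_le (fun m => visitProb_nonneg _ m y)
    (fun _ => measureReal_mono Set.inter_subset_left) (summable_measureReal_avoiding next hP)

/-- The expected number of visits of `y` before the first transition from a marked letter. -/
noncomputable def expectedVisits (P : W → Prop) (y : W) : ℝ :=
  ∑' m, visitProb (markedStep next P) m y

/-- The expected number of visits of a letter with unmarked predecessor. -/
noncomputable def freeVisits (P : W → Prop) : ℝ :=
  (1 + ∑' m, (iidUniform W).real (avoiding (markedStep next P) m)) / Fintype.card W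

lemma freeVisits_pos : 0 < freeVisits next P := by
  have hq : (0 : ℝ) < Fintype.card W := by exact_mod_cast Fintype.card_pos
  have : 0 ≤ ∑' m, (iidUniform W).real (avoiding (markedStep next P) m) :=
    tsum_nonneg fun m => measureReal_nonneg
  unfold freeVisits
  positivity

-- This is the recursion for `visitProb` summed over time. The visit at time `0`, of probability `1
-- / |W|`, accounts for the `1` in `freeVisits`.
open Classical in
lemma expectedVisits_next (hP : ∃ y, P y) (y : W) :
    expectedVisits next P (next y) =
      freeVisits next P - (if P y then expectedVisits next P y else 0) / Fintype.card W := by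
  have h1 : Summable fun m => if P y then visitProb (markedStep next P) m y else 0 := by
    split_ifs
    · exact summable_visitProb next hP y
    · exact summable_zero
  rw [expectedVisits, (summable_visitProb next hP _).tsum_eq_zero_add, visitProb_zero]
  simp_rw [visitProb_markedStep_succ]
  rw [tsum_div_const, (summable_measureReal_avoiding next hP).tsum_sub h1, freeVisits]
  have h2 : ∑' m, (if P y then visitProb (markedStep next P) m y else 0) =
      if P y then expectedVisits next P y else 0 := by
    split_ifs
    · rfl
    · exact tsum_zero
  rw [h2]
  ring

open Classical in
lemma hasSum_stepProb (hP : ∃ y, P y) (P' : W → Prop) :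
    HasSum (stepProb (markedStep next P) (markedStep next P'))
      ((∑ y, if P' y then expectedVisits next P y else 0) / Fintype.card W) := by
  have : stepProb (markedStep next P) (markedStep next P') = fun m =>
      (∑ y, if P' y then visitProb (markedStep next P) m y else 0) / Fintype.card W :=
    funext fun m => stepProb_markedStep next P P' m
  rw [this]
  refine (hasSum_sum fun y _ => ?_).div_const _
  split_ifs
  · exact (summable_visitProb next hP y).hasSum
  · exact hasSum_zero

lemma tendsto_measureReal_avoiding (hP : ∃ y, P y) :
    Filter.Tendsto (fun m => (iidUniform W).real (avoiding (markedStep next P) m))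
      Filter.atTop (nhds 0) :=
  (summable_measureReal_avoiding next hP).tendsto_atTop_zero

/-- Almost surely there is a transition from a marked letter. -/
lemma hasSum_stepProb_self (hP : ∃ y, P y) :
    HasSum (stepProb (markedStep next P) (markedStep next P)) 1 := by
  rw [hasSum_iff_tendsto_nat_of_nonneg (stepProb_nonneg _ _)]
  simp_rw [sum_range_stepProb]
  simpa using (tendsto_measureReal_avoiding next hP).const_sub 1

open Classical in
/-- If no two consecutive letters are marked, the law of the time of the first transition from a
marked letter depends only on the number of marked letters. -/
lemma measureReal_avoiding_eq {P' : W → Prop} (hP : ∀ y, P y → ¬ P (next y))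
    (hP' : ∀ y, P' y → ¬ P' (next y))
    (hcard : ∑ y, (if P y then (1 : ℝ) else 0) = ∑ y, if P' y then (1 : ℝ) else 0) (m : ℕ) :
    (iidUniform W).real (avoiding (markedStep next P) m) =
      (iidUniform W).real (avoiding (markedStep next P') m) := by
  have zero : ∀ P : W → Prop, stepProb (markedStep next P) (markedStep next P) 0 =
      (∑ y, if P y then (1 : ℝ) else 0) / Fintype.card W / Fintype.card W := by
    intro P
    rw [stepProb_markedStep]
    congr 1
    rw [Finset.sum_div]
    refine Finset.sum_congr rfl fun y _ => ?_
    split_ifs <;> simp [visitProb_zero]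
  -- A marked letter has an unmarked predecessor, so it is visited at time `m + 1` with probability
  -- `a m / q`, where `a` is the survival probability. With `N` marked letters this gives `a (m + 2)
  -- = a (m + 1) - N * a m / q ^ 2`, which determines `a` from `N`, `q` and its first two values.
  have succ : ∀ P : W → Prop, (∀ y, P y → ¬ P (next y)) → ∀ m,
      stepProb (markedStep next P) (markedStep next P) (m + 1) =
      (∑ y, if P y then (1 : ℝ) else 0) *
        (iidUniform W).real (avoiding (markedStep next P) m) / Fintype.card W /
          Fintype.card W := by
    intro P hP m
    rw [stepProb_markedStep]
    congr 1
    rw [Finset.sum_mul, Finset.sum_div]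
    refine Finset.sum_congr rfl fun y _ => ?_
    split_ifs with hy
    · obtain ⟨z, rfl⟩ := next.surjective y
      rw [visitProb_markedStep_succ, if_neg fun hz => hP z hz hy]
      simp
    · simp
  induction m using Nat.twoStepInduction with
  | zero => simp [avoiding_zero]
  | one => simp [measureReal_avoiding_succ, avoiding_zero, zero, hcard]
  | more m h1 h2 =>
    rw [measureReal_avoiding_succ, measureReal_avoiding_succ _ (m + 1), h2, succ P hP,
      succ P' hP', hcard, h1]

end Marked

/-! ### Hitting times of labelled transitions -/

section Labelled

set_option linter.unusedSectionVars false

variable {W : Type u} [Fintype W] [Nonempty W] [MeasurableSpace W] [DiscreteMeasurableSpace W]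
  {S : Type v} (e : W × W ≃ S) {n : ℕ} (next : Equiv.Perm W) (lab : W → Option (Fin n))

/-- The letters with a label in `C`. -/
def labelledIn (C : Finset (Fin n)) (y : W) : Prop := ∃ c ∈ C, lab y = some c

/-- The pairs `(y, next y)` where `y` has label `i`. -/
def labelledPairs (i : Fin n) : Set S :=
  {s | markedStep next (labelledIn lab {i}) (e.symm s).1 (e.symm s).2}

/-- The first time of a transition from a letter with label `i` to its successor. -/
noncomputable def labelledTime (i : Fin n) : (ℕ → W) → ℕ∞ :=
  hitTime (pairChain e) (labelledPairs e next lab i)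

lemma natCast_le_labelledTime (i : Fin n) (m : ℕ) (ω : ℕ → W) :
    (m : ℕ∞) ≤ labelledTime e next lab i ω ↔
      ω ∈ avoiding (markedStep next (labelledIn lab {i})) m := by
  rw [labelledTime, hitTime_ge_iff]
  simp [labelledPairs, pairChain, avoiding]

/-- The minimum over `C` is again the first time of a marked transition, now with all labels in `C`
as marks, so the results on one marking apply to it. -/
lemma natCast_le_minTime (C : Finset (Fin n)) (m : ℕ) (ω : ℕ → W) :
    (m : ℕ∞) ≤ minTime (labelledTime e next lab) C ω ↔
      ω ∈ avoiding (markedStep next (labelledIn lab C)) m := by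
  rw [minTime, Finset.le_inf_iff]
  simp_rw [natCast_le_labelledTime]
  simp only [avoiding, markedStep, labelledIn, Finset.mem_singleton, exists_eq_left,
    Set.mem_ofPred_eq]
  constructor
  · rintro h k hk ⟨h1, c, hc, h2⟩
    exact h c hc k hk ⟨h1, h2⟩
  · rintro h c hc k hk ⟨h1, h2⟩
    exact h k hk ⟨h1, c, hc, h2⟩

lemma measurableSet_natCast_le_labelledTime (i : Fin n) (m : ℕ) :
    MeasurableSet {ω | (m : ℕ∞) ≤ labelledTime e next lab i ω} := by
  simp_rw [natCast_le_labelledTime]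
  exact (dependsOnUpTo_avoiding _ m).measurableSet

lemma measurable_labelledTime (i : Fin n) : Measurable (labelledTime e next lab i) := by
  have hge := measurableSet_natCast_le_labelledTime e next lab i
  refine measurable_to_countable' fun x => ?_
  induction x using ENat.recTopCoe with
  | top =>
    have : labelledTime e next lab i ⁻¹' {⊤} =
        ⋂ m : ℕ, {ω | (m : ℕ∞) ≤ labelledTime e next lab i ω} := by
      ext ω
      simp [ENat.eq_top_iff_forall_ge]
    rw [this]
    exact MeasurableSet.iInter hge
  | coe m =>
    have : labelledTime e next lab i ⁻¹' {(m : ℕ∞)} =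
        {ω | (m : ℕ∞) ≤ labelledTime e next lab i ω} \
          {ω | ((m + 1 : ℕ) : ℕ∞) ≤ labelledTime e next lab i ω} := by
      ext ω
      simp only [Set.mem_preimage, Set.mem_singleton_iff, Set.mem_sdiff, Set.mem_ofPred_eq,
        not_le, Nat.cast_add, Nat.cast_one, ENat.lt_natCast_add_one_iff]
      exact ⟨fun h => ⟨h.ge, h.le⟩, fun h => le_antisymm h.2 h.1⟩
    rw [this]
    exact (hge m).diff (hge (m + 1))

lemma ae_labelledTime_ne_top (i : Fin n) (hi : ∃ y, lab y = some i) :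
    ∀ᵐ ω ∂iidUniform W, labelledTime e next lab i ω ≠ ⊤ := by
  have hP : ∃ y, labelledIn lab {i} y := by simpa [labelledIn] using hi
  rw [ae_iff]
  simp only [not_not]
  rw [← measureReal_eq_zero_iff]
  refine le_antisymm (ge_of_tendsto' (tendsto_measureReal_avoiding next hP) fun m => ?_)
    measureReal_nonneg
  refine measureReal_mono fun ω hω => ?_
  rw [Set.mem_ofPred_eq] at hω
  rw [← natCast_le_labelledTime e, hω]
  exact le_top

/-- The times are almost surely finite, and a tie at time `m` would give the letter `ω m` two
labels. -/
lemma noTie_labelledTime (hlab : ∀ i, ∃ y, lab y = some i) :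
    NoTie (iidUniform W) (labelledTime e next lab) := by
  intro i j hij
  filter_upwards [ae_labelledTime_ne_top e next lab i (hlab i)] with ω hω heq
  obtain ⟨m, hm⟩ := ENat.ne_top_iff_exists.1 hω
  have key : ∀ k, labelledTime e next lab k ω = (m : ℕ∞) → lab (ω m) = some k := by
    intro k hk
    have h1 := (natCast_le_labelledTime e next lab k m ω).1 hk.ge
    have h2 : ω ∉ avoiding (markedStep next (labelledIn lab {k})) (m + 1) := by
      rw [← natCast_le_labelledTime e, hk, not_le]
      exact ENat.natCast_lt_natCast.2 (Nat.lt_succ_self m)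
    rw [avoiding_succ] at h2
    have h3 : markedStep next (labelledIn lab {k}) (ω m) (ω (m + 1)) := by
      by_contra h4
      exact h2 ⟨h1, h4⟩
    simpa [labelledIn] using h3.2
  have hi := key i hm.symm
  have hj := key j (heq ▸ hm.symm)
  exact hij (Option.some.inj (hi.symm.trans hj))

open Classical in
lemma identDistrib_labelledTime {N : ℝ} (hlab : ∀ i, ∃ y, lab y = some i)
    (hnext : ∀ y i, lab y = some i → lab (next y) ≠ some i)
    (hN : ∀ i, ∑ y, (if lab y = some i then (1 : ℝ) else 0) = N) :
    IdenticallyDistributed (iidUniform W) (labelledTime e next lab) := by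
  intro i j
  refine ⟨(measurable_labelledTime e next lab i).aemeasurable,
    (measurable_labelledTime e next lab j).aemeasurable, ?_⟩
  have hge : ∀ m : ℕ, (iidUniform W).real {ω | (m : ℕ∞) ≤ labelledTime e next lab i ω} =
      (iidUniform W).real {ω | (m : ℕ∞) ≤ labelledTime e next lab j ω} := by
    intro m
    simp_rw [natCast_le_labelledTime]
    refine measureReal_avoiding_eq next ?_ ?_ ?_ m
    · simpa [labelledIn] using fun y => hnext y i
    · simpa [labelledIn] using fun y => hnext y j
    · simp [labelledIn, hN]
  refine Measure.ext_of_singleton fun x => ?_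
  rw [Measure.map_apply (measurable_labelledTime e next lab i) (measurableSet_singleton x),
    Measure.map_apply (measurable_labelledTime e next lab j) (measurableSet_singleton x)]
  induction x using ENat.recTopCoe with
  | top =>
    have h := fun k => ae_iff.1 (ae_labelledTime_ne_top e next lab k (hlab k))
    simp only [not_not] at h
    exact (h i).trans (h j).symm
  | coe m =>
    have hm : ∀ k, (iidUniform W).real (labelledTime e next lab k ⁻¹' {(m : ℕ∞)}) =
        (iidUniform W).real {ω | (m : ℕ∞) ≤ labelledTime e next lab k ω} -
          (iidUniform W).real {ω | ((m + 1 : ℕ) : ℕ∞) ≤ labelledTime e next lab k ω} := by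
      intro k
      rw [← measureReal_sdiff]
      · congr 1
        ext ω
        simp only [Set.mem_preimage, Set.mem_singleton_iff, Set.mem_sdiff, Set.mem_ofPred_eq,
          not_le, Nat.cast_add, Nat.cast_one, ENat.lt_natCast_add_one_iff]
        exact ⟨fun h => ⟨h.ge, h.le⟩, fun h => le_antisymm h.2 h.1⟩
      · intro ω hω
        exact le_trans (ENat.natCast_le_natCast.2 (Nat.le_succ m)) (Set.mem_ofPred.1 hω)
      · exact measurableSet_natCast_le_labelledTime e next lab k (m + 1)
    rw [← measureReal_eq_measureReal_iff, hm, hm, hge, hge]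

lemma lt_iff_exists_natCast (x y : ℕ∞) :
    x < y ↔ ∃ m : ℕ, (m : ℕ∞) ≤ x ∧ ¬ ((m + 1 : ℕ) : ℕ∞) ≤ x ∧ ((m + 1 : ℕ) : ℕ∞) ≤ y := by
  constructor
  · intro h
    obtain ⟨m, rfl⟩ := ENat.ne_top_iff_exists.1 h.ne_top
    refine ⟨m, le_rfl, ?_, ?_⟩
    · rw [not_le]
      exact ENat.natCast_lt_natCast.2 (Nat.lt_succ_self m)
    · push_cast
      exact Order.add_one_le_of_lt h
  · rintro ⟨m, -, h1, h2⟩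
    exact (not_le.1 h1).trans_le h2

open Classical in
/-- The probability that a label in `A` comes before all labels in `B`. -/
lemma hasSum_minTime_lt {A B : Finset (Fin n)} (hAB : Disjoint A B) :
    HasSum (stepProb (markedStep next (labelledIn lab (A ∪ B))) (markedStep next (labelledIn lab A)))
      ((iidUniform W).real {ω | minTime (labelledTime e next lab) A ω <
        minTime (labelledTime e next lab) B ω}) := by
  set E : ℕ → Set (ℕ → W) := fun m => avoiding (markedStep next (labelledIn lab (A ∪ B))) m ∩
    {ω | markedStep next (labelledIn lab A) (ω m) (ω (m + 1))}
  have hunion : ∀ m (ω : ℕ → W), ω ∈ avoiding (markedStep next (labelledIn lab (A ∪ B))) m ↔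
      ω ∈ avoiding (markedStep next (labelledIn lab A)) m ∧
        ω ∈ avoiding (markedStep next (labelledIn lab B)) m := by
    intro m ω
    simp_rw [← natCast_le_minTime e, minTime, Finset.inf_union, le_inf_iff]
  have hdisj : ∀ y z, markedStep next (labelledIn lab A) y z →
      ¬ markedStep next (labelledIn lab B) y z := by
    rintro y z ⟨-, a, ha, h1⟩ ⟨-, b, hb, h2⟩
    have : a = b := Option.some.inj (h1.symm.trans h2)
    exact Finset.disjoint_left.1 hAB ha (this ▸ hb)
  -- Split by the time `m` of the first transition with label in `A ∪ B`; `A` wins exactly when its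
  -- label lies in `A`.
  have hE : {ω | minTime (labelledTime e next lab) A ω < minTime (labelledTime e next lab) B ω} =
      ⋃ m, E m := by
    ext ω
    simp only [Set.mem_ofPred_eq, Set.mem_iUnion, lt_iff_exists_natCast, natCast_le_minTime, E,
      Set.mem_inter_iff, hunion, avoiding_succ]
    refine exists_congr fun m => ?_
    have := hdisj (ω m) (ω (m + 1))
    tauto
  have hmeas : ∀ m, MeasurableSet (E m) := fun m =>
    DependsOnUpTo.measurableSet (m := m + 1) fun ω ω' h hω =>
      ⟨dependsOnUpTo_avoiding _ m ω ω' (fun k hk => h k (by omega)) hω.1, by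
        have h2 := hω.2
        rwa [Set.mem_ofPred_eq, h m (by omega), h (m + 1) le_rfl] at h2⟩
  have hpair : Pairwise (Function.onFun Disjoint E) := by
    refine pairwise_disjoint_on E |>.2 fun k m hkm => Set.disjoint_left.2 fun ω h1 h2 => ?_
    exact ((hunion m ω).1 h2.1).1 k hkm h1.2
  rw [hE]
  have h := measure_iUnion (μ := iidUniform W) hpair hmeas
  have h2 := ENNReal.hasSum_toReal (h ▸ measure_ne_top (iidUniform W) (⋃ m, E m))
  rw [← ENNReal.tsum_toReal_eq fun m => measure_ne_top _ _, ← h] at h2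
  exact h2

end Labelled

/-! ### The labelling given by a tournament -/

section TournamentLabels

variable {n : ℕ}

/-- Three letters for every pair of vertices. -/
abbrev ArrowLetter (n : ℕ) : Type u := ULift.{u} (Fin n × Fin n × Fin 3)

/-- The cyclic successor among the three letters of a pair. -/
def nextLetter (n : ℕ) : Equiv.Perm (ArrowLetter.{u} n) :=
  (Equiv.ulift.trans ((Equiv.refl _).prodCongr ((Equiv.refl _).prodCongr (Equiv.addRight 1)))).trans
    Equiv.ulift.symm

open Classical in
/-- For an arrow `i → j` of `G`, the first letter of `(i, j)` has label `j` and the second one has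
label `i`. All other letters have no label. -/
noncomputable def arrowLabel (G : Digraph (Fin n)) (y : ArrowLetter.{u} n) : Option (Fin n) :=
  if G.Adj y.down.1 y.down.2.1 then
    if y.down.2.2 = 0 then some y.down.2.1 else
    if y.down.2.2 = 1 then some y.down.1 else none
  else none

open Classical in
lemma sum_arrowLabel (G : Digraph (Fin n)) (c : Fin n) (f : ArrowLetter.{u} n → ℝ) :
    ∑ y, (if arrowLabel G y = some c then f y else 0) =
      ∑ j, ((if G.Adj j c then f ⟨(j, c, 0)⟩ else 0) +
        if G.Adj c j then f ⟨(c, j, 1)⟩ else 0) := by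
  rw [← Equiv.ulift.symm.sum_comp, Fintype.sum_prod_type]
  simp_rw [Fintype.sum_prod_type, Fin.sum_univ_three]
  have h : ∀ i j : Fin n,
      ((if arrowLabel.{u} G ⟨(i, j, 0)⟩ = some c then f ⟨(i, j, 0)⟩ else 0) +
        (if arrowLabel.{u} G ⟨(i, j, 1)⟩ = some c then f ⟨(i, j, 1)⟩ else 0) +
        if arrowLabel.{u} G ⟨(i, j, 2)⟩ = some c then f ⟨(i, j, 2)⟩ else 0) =
      (if j = c then (if G.Adj i c then f ⟨(i, c, 0)⟩ else 0) else 0) +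
        if i = c then (if G.Adj c j then f ⟨(c, j, 1)⟩ else 0) else 0 := by
    intro i j
    have h0 : arrowLabel G (⟨(i, j, 0)⟩ : ArrowLetter.{u} n) = some c ↔ G.Adj i j ∧ j = c := by
      simp [arrowLabel]
    have h1 : arrowLabel G (⟨(i, j, 1)⟩ : ArrowLetter.{u} n) = some c ↔ G.Adj i j ∧ i = c := by
      simp [arrowLabel]
    have h2 : ¬ arrowLabel G (⟨(i, j, 2)⟩ : ArrowLetter.{u} n) = some c := by
      simp [arrowLabel]
    simp only [h0, h1, h2, if_false, add_zero]
    congr 1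
    · by_cases hj : j = c
      · subst hj; simp
      · simp [hj]
    · by_cases hi : i = c
      · subst hi; simp
      · simp [hi]
  refine (Finset.sum_congr rfl fun i _ => Finset.sum_congr rfl fun j _ => h i j).trans ?_
  simp_rw [Finset.sum_add_distrib]
  congr 1
  · simp
  · rw [Finset.sum_comm]
    simp

open Classical in
lemma sum_labelledIn {W : Type*} [Fintype W] (lab : W → Option (Fin n)) (A : Finset (Fin n))
    (f : W → ℝ) :
    ∑ y, (if labelledIn lab A y then f y else 0) =
      ∑ a ∈ A, ∑ y, if lab y = some a then f y else 0 := by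
  rw [Finset.sum_comm]
  refine Finset.sum_congr rfl fun y _ => ?_
  cases h : lab y with
  | none => simp [labelledIn, h]
  | some i => simp [labelledIn, h]

variable {G : Digraph (Fin n)}

lemma not_adj_of_adj (hG : IsTournament G) {i j : Fin n} (h : G.Adj i j) : ¬ G.Adj j i := by
  intro h'
  have hij : i ≠ j := fun hh => hG.1 j (hh ▸ h)
  rcases hG.2 i j hij with h1 | h1
  · exact h1.2 h'
  · exact h1.2 h

-- Every vertex other than `c` shares exactly one arrow with `c`, in whichever direction. Hence all
-- labels occur equally often, whatever the degrees.
open Classical in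
lemma sum_adj_add_adj (hG : IsTournament G) (c : Fin n) :
    ∑ j, ((if G.Adj j c then (1 : ℝ) else 0) + if G.Adj c j then 1 else 0) = n - 1 := by
  have h : ∀ j, ((if G.Adj j c then (1 : ℝ) else 0) + if G.Adj c j then 1 else 0) =
      1 - if j = c then 1 else 0 := by
    intro j
    by_cases hj : j = c
    · subst hj; simp [hG.1]
    · rcases hG.2 j c hj with h | h <;> simp [h, hj]
  simp [h]

lemma exists_arrowLabel_eq (hG : IsTournament G) (hn : 2 ≤ n) (i : Fin n) :
    ∃ y : ArrowLetter.{u} n, arrowLabel G y = some i := by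
  have : Nontrivial (Fin n) := Fin.nontrivial_iff_two_le.2 hn
  obtain ⟨j, hj⟩ := exists_ne i
  rcases hG.2 j i hj with h | h
  · exact ⟨⟨(j, i, 0)⟩, by simp [arrowLabel, h.1]⟩
  · exact ⟨⟨(i, j, 1)⟩, by simp [arrowLabel, h.1]⟩

/-- The two labelled letters of an arrow carry its two distinct ends, and the third letter separates
them around the cycle. -/
lemma arrowLabel_nextLetter (hG : IsTournament G) (y : ArrowLetter.{u} n) (i : Fin n)
    (hy : arrowLabel G y = some i) : arrowLabel G (nextLetter n y) ≠ some i := by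
  obtain ⟨a, b, t⟩ := y
  by_cases hab : G.Adj a b
  · have hne : a ≠ b := fun h => hG.1 b (h ▸ hab)
    fin_cases t <;> simp [arrowLabel, nextLetter, hab] at hy ⊢
    rw [← hy]
    exact hne
  · simp [arrowLabel, hab] at hy

variable [MeasurableSpace (ArrowLetter.{u} n)] [DiscreteMeasurableSpace (ArrowLetter.{u} n)]
  [Nonempty (ArrowLetter.{u} n)]

open Classical in
/-- The expected number of transitions with label `a` before any transition with label in `C`
decreases with the out-degree of `a` in `C`. -/
lemma sum_expectedVisits_arrowLabel (hG : IsTournament G) (hn : 2 ≤ n) (C : Finset (Fin n))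
    {a : Fin n} (ha : a ∈ C) :
    ∑ y, (if arrowLabel G y = some a then
        expectedVisits (nextLetter n) (labelledIn (arrowLabel.{u} G) C) y else 0) =
      freeVisits (nextLetter n) (labelledIn (arrowLabel.{u} G) C) *
        ((n - 1) - (C.filter (G.Adj a)).card / Fintype.card (ArrowLetter.{u} n)) := by
  set κ := freeVisits (nextLetter n) (labelledIn (arrowLabel.{u} G) C)
  have hP : ∃ y, labelledIn (arrowLabel.{u} G) C y := by
    obtain ⟨y, hy⟩ := exists_arrowLabel_eq hG hn a
    exact ⟨y, a, ha, hy⟩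
  -- The predecessor of a first letter is a third letter, which has no label: no visits are lost.
  have h0 : ∀ i j, expectedVisits (nextLetter n) (labelledIn (arrowLabel.{u} G) C)
      ⟨(i, j, 0)⟩ = κ := by
    intro i j
    have hnext : (⟨(i, j, 0)⟩ : ArrowLetter.{u} n) = nextLetter n ⟨(i, j, 2)⟩ := by
      simp [nextLetter]
    rw [hnext, expectedVisits_next _ hP, if_neg (by simp [labelledIn, arrowLabel])]
    simp [κ]
  -- The predecessor of the second letter is the first one, labelled `j`. If `j ∈ C`, arriving that
  -- way stops the process, at a cost of `κ / q` visits.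
  have h1 : ∀ i j, G.Adj i j →
      expectedVisits (nextLetter n) (labelledIn (arrowLabel.{u} G) C) ⟨(i, j, 1)⟩ =
        κ - if j ∈ C then κ / Fintype.card (ArrowLetter.{u} n) else 0 := by
    intro i j hij
    have hnext : (⟨(i, j, 1)⟩ : ArrowLetter.{u} n) = nextLetter n ⟨(i, j, 0)⟩ := by
      simp [nextLetter]
    rw [hnext, expectedVisits_next _ hP, h0]
    by_cases hj : j ∈ C <;> simp [labelledIn, arrowLabel, hij, hj, κ]
  rw [sum_arrowLabel]
  have h2 : ∀ j, ((if G.Adj j a then expectedVisits (nextLetter n)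
        (labelledIn (arrowLabel.{u} G) C) ⟨(j, a, 0)⟩ else 0) +
      if G.Adj a j then expectedVisits (nextLetter n)
        (labelledIn (arrowLabel.{u} G) C) ⟨(a, j, 1)⟩ else 0) =
      κ * ((if G.Adj j a then (1 : ℝ) else 0) + if G.Adj a j then 1 else 0) -
        κ / Fintype.card (ArrowLetter.{u} n) * if j ∈ C.filter (G.Adj a) then 1 else 0 := by
    intro j
    by_cases haj : G.Adj a j
    · by_cases hj : j ∈ C <;> simp [h0, h1 a j haj, haj, hj] <;> split_ifs <;> ring
    · simp [h0, haj]
  simp_rw [h2]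
  rw [Finset.sum_sub_distrib, ← Finset.mul_sum, ← Finset.mul_sum, sum_adj_add_adj hG,
    Finset.sum_boole, Finset.filter_mem_eq_inter, Finset.univ_inter]
  ring

variable {S : Type v} (e : ArrowLetter.{u} n × ArrowLetter.{u} n ≃ S)

/-- If all arrows from `A` to `B` are present, then the labels in `B` have an advantage. -/
lemma expectedPayoff_labelledTime_pos (hG : IsTournament G) (hn : 2 ≤ n) {A B : Finset (Fin n)}
    (hA : A.Nonempty) (hB : B.Nonempty) (hAB : Disjoint A B)
    (hadj : ∀ i ∈ A, ∀ j ∈ B, G.Adj i j) :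
    0 < expectedPayoff (iidUniform (ArrowLetter.{u} n))
      (labelledTime e (nextLetter n) (arrowLabel G)) A B := by
  classical
  rw [expectedPayoff_eq _ _ fun i => (measurable_labelledTime e _ _ i).aemeasurable]
  set p := (iidUniform (ArrowLetter.{u} n)).real
    {ω | minTime (labelledTime e (nextLetter n) (arrowLabel G)) A ω <
      minTime (labelledTime e (nextLetter n) (arrowLabel G)) B ω}
  have hP : ∃ y, labelledIn (arrowLabel.{u} G) (A ∪ B) y := by
    obtain ⟨a, ha⟩ := hA
    obtain ⟨y, hy⟩ := exists_arrowLabel_eq hG hn a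
    exact ⟨y, a, Finset.mem_union_left _ ha, hy⟩
  set κ := freeVisits (nextLetter n) (labelledIn (arrowLabel.{u} G) (A ∪ B)) with hκdef
  have hκ : 0 < κ := freeVisits_pos _
  set q : ℝ := (Fintype.card (ArrowLetter.{u} n) : ℝ) with hqdef
  have hq : 0 < q := by
    rw [hqdef]
    exact_mod_cast Fintype.card_pos
  let d : Fin n → ℝ := fun c => ((A ∪ B).filter (G.Adj c)).card
  have hsum : ∀ D ⊆ A ∪ B, (∑ y, if labelledIn (arrowLabel.{u} G) D y then
      expectedVisits (nextLetter n) (labelledIn (arrowLabel.{u} G) (A ∪ B)) y else 0) =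
      κ * (D.card * (n - 1) - (∑ c ∈ D, d c) / q) := by
    intro D hD
    rw [sum_labelledIn, Finset.sum_congr rfl fun c hc =>
      sum_expectedVisits_arrowLabel hG hn (A ∪ B) (hD hc), ← Finset.mul_sum,
      Finset.sum_sub_distrib, ← Finset.sum_div]
    rw [Finset.sum_const, nsmul_eq_mul]
  have hp : p = κ * (A.card * (n - 1) - (∑ c ∈ A, d c) / q) / q := by
    rw [← hsum A Finset.subset_union_left]
    exact (hasSum_minTime_lt e (nextLetter n) (arrowLabel G) hAB).unique
      (hasSum_stepProb _ hP _)
  -- Some label in `A ∪ B` almost surely stops the process. Writing `1` in this form makes the terms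
  -- `n - 1` cancel in `hkey`.
  have hone : 1 = κ * ((A.card + B.card) * (n - 1) - (∑ c ∈ A, d c + ∑ c ∈ B, d c) / q) / q := by
    rw [← Finset.sum_union hAB, ← Nat.cast_add, ← Finset.card_union_of_disjoint hAB,
      ← hsum _ subset_rfl]
    exact (hasSum_stepProb_self _ hP).unique (hasSum_stepProb _ hP _)
  have hdA : (A.card : ℝ) * B.card ≤ ∑ c ∈ A, d c := by
    rw [← nsmul_eq_mul]
    refine Finset.card_nsmul_le_sum _ _ _ fun a ha => ?_
    exact Nat.cast_le.2 <| Finset.card_le_card fun b hb =>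
      Finset.mem_filter.2 ⟨Finset.mem_union_right _ hb, hadj a ha b hb⟩
  -- No arrow goes back from `B` to `A`, so out-neighbours of `b` inside `A ∪ B` lie in `B` without
  -- `b`.
  have hdB : ∑ c ∈ B, d c ≤ B.card * (B.card - 1) := by
    rw [← nsmul_eq_mul]
    refine Finset.sum_le_card_nsmul _ _ _ fun b hb => ?_
    have h1 : (A ∪ B).filter (G.Adj b) ⊆ B.erase b := by
      intro c hc
      obtain ⟨hc, hbc⟩ := Finset.mem_filter.1 hc
      refine Finset.mem_erase.2 ⟨fun h => hG.1 b (h ▸ hbc), ?_⟩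
      rcases Finset.mem_union.1 hc with hc | hc
      · exact absurd hbc (not_adj_of_adj hG (hadj c hc b hb))
      · exact hc
    have h2 := Finset.card_le_card h1
    rw [Finset.card_erase_of_mem hb] at h2
    have h3 : 1 ≤ B.card := hB.card_pos
    have h4 : ((A ∪ B).filter (G.Adj b)).card + 1 ≤ B.card := by omega
    have h5 : (((A ∪ B).filter (G.Adj b)).card : ℝ) + 1 ≤ B.card := by exact_mod_cast h4
    have h6 : d b = ((A ∪ B).filter (G.Adj b)).card := rfl
    linarith
  have hA' : (0 : ℝ) < A.card := by exact_mod_cast hA.card_pos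
  have hB' : (0 : ℝ) < B.card := by exact_mod_cast hB.card_pos
  have hkey : (A.card : ℝ) * (1 - p) - B.card * p =
      κ / q ^ 2 * (B.card * ∑ c ∈ A, d c - A.card * ∑ c ∈ B, d c) := by
    rw [hone, hp]
    field_simp
    ring
  rw [hkey]
  have h1 := mul_le_mul_of_nonneg_left hdA hB'.le
  have h2 := mul_le_mul_of_nonneg_left hdB hA'.le
  have h3 := mul_pos hA' hB'
  refine mul_pos (by positivity) ?_
  -- The bracket is at least `|A| |B| ^ 2 - |A| |B| (|B| - 1) = |A| |B|`.
  nlinarith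

end TournamentLabels

/-- Player II answers `A` with the set `B` supplied by the tournament. All arrows from `A` to `B`
persist between any `A' ⊆ A` and `B' ⊆ B`, so no final choice helps Player I. -/
theorem isFavorable_labelledTime {n r₁ r₂ : ℕ} (hr₁ : 1 ≤ r₁) (hr₂ : 1 ≤ r₂)
    (hn : r₁ + r₂ ≤ n) {G : Digraph (Fin n)} (hG : IsTournament G) (hD : IsDirectional G r₁ r₂)
    [MeasurableSpace (ArrowLetter.{u} n)] [DiscreteMeasurableSpace (ArrowLetter.{u} n)]
    [Nonempty (ArrowLetter.{u} n)] {S : Type v}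
    (e : ArrowLetter.{u} n × ArrowLetter.{u} n ≃ S) :
    IsFavorable (iidUniform (ArrowLetter.{u} n)) (labelledTime e (nextLetter n) (arrowLabel G))
      r₁ r₂ := by
  refine ⟨hn, (gameValue_pos_iff _ _ hr₁ hr₂ hn).2 fun A hA => ?_⟩
  obtain ⟨B, hB, hAB, hadj⟩ := hD A hA
  exact ⟨B, hB, hAB, fun A' B' h1 h2 h3 h4 =>
    expectedPayoff_labelledTime_pos e hG (by omega) h1 h3
      (Finset.disjoint_of_subset_left h2 (Finset.disjoint_of_subset_right h4 hAB))
      fun i hi j hj => hadj i (h2 hi) j (h4 hj)⟩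

theorem theorem4p1 (r₁ r₂ : ℕ) (hr₁ : 1 ≤ r₁) (hr₂ : 1 ≤ r₂) :
    (directionalOrders r₁ r₂).Nonempty ∧
    ∀ n : ℕ,
      (∃ (Ω : Type u) (_ : MeasurableSpace Ω) (μ : Measure Ω) (_ : IsProbabilityMeasure μ)
          (S : Type v) (_ : Fintype S) (_ : MeasurableSpace S) (_ : DiscreteMeasurableSpace S)
          (X : ℕ → Ω → S) (F : Fin n → Set S),
        IsOneDependentUniformChain μ X ∧
        NoTie μ (fun i => hitTime X (F i)) ∧
        IdenticallyDistributed μ (fun i => hitTime X (F i)) ∧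
        IsFavorable μ (fun i => hitTime X (F i)) r₁ r₂) ↔
      threshold r₁ r₂ ≤ n := by
  refine ⟨directionalOrders_nonempty r₁ r₂, fun n => ⟨?_, fun hn => ?_⟩⟩
  · rintro ⟨Ω, _, μ, _, S, _, _, _, X, F, -, hnt, hid, hfav⟩
    exact Nat.sInf_le (mem_directionalOrders_of_isFavorable μ _
      (fun i => (hid i i).aemeasurable_fst) hnt hr₁ hr₂ hfav)
  · obtain ⟨hle, G, hG, hD⟩ := mem_directionalOrders_of_le hr₁
      (Nat.sInf_mem (directionalOrders_nonempty r₁ r₂)) hn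
    have hn2 : 2 ≤ n := by omega
    have : Nonempty (ArrowLetter.{u} n) := ⟨⟨(⟨0, by omega⟩, ⟨0, by omega⟩, 0)⟩⟩
    let _ : MeasurableSpace (ArrowLetter.{u} n) := ⊤
    have : DiscreteMeasurableSpace (ArrowLetter.{u} n) := ⟨fun _ => trivial⟩
    let _ : MeasurableSpace (ArrowLetter.{v} n × ArrowLetter.{v} n) := ⊤
    have : DiscreteMeasurableSpace (ArrowLetter.{v} n × ArrowLetter.{v} n) := ⟨fun _ => trivial⟩
    -- The sample space lives in universe `u` and the state space in `v`; the states are therefore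
    -- pairs from a copy of the alphabet.
    let e₀ : ArrowLetter.{u} n ≃ ArrowLetter.{v} n := Equiv.ulift.trans Equiv.ulift.symm
    let e : ArrowLetter.{u} n × ArrowLetter.{u} n ≃ ArrowLetter.{v} n × ArrowLetter.{v} n :=
      e₀.prodCongr e₀
    refine ⟨ℕ → ArrowLetter.{u} n, inferInstance, iidUniform (ArrowLetter.{u} n), inferInstance,
      ArrowLetter.{v} n × ArrowLetter.{v} n, inferInstance, inferInstance, inferInstance,
      pairChain e, labelledPairs e (nextLetter n) (arrowLabel G),
      isOneDependentUniformChain_pairChain e,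
      noTie_labelledTime e _ _ (exists_arrowLabel_eq hG hn2),
      identDistrib_labelledTime e _ _ (exists_arrowLabel_eq hG hn2)
        (arrowLabel_nextLetter hG) (N := n - 1) (fun i => ?_),
      isFavorable_labelledTime hr₁ hr₂ hle hG hD e⟩
    rw [sum_arrowLabel, sum_adj_add_adj hG]
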